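/- Let $A$ be either the algebra $\mathbb H$ of quaternions or the algebra $\mathbb O$ of octonions, with conjugation $x\mapsto x^c$ and the Euclidean topology. Let $\mathbb S_A=\{I\in A: I+I^c=0,\ II^c=1\}$ be its sphere of imaginary units, and for $I\in\mathbb S_A$ let $\phi_I:\mathbb C\to A$, $\phi_I(\alpha+\iota\beta)=\alpha+\beta I$, and $\mathbb C_I=\phi_I(\mathbb C)$. Let $A\otimes_{\mathbb R}\mathbb C=\{x+\iota y: x,y\in A\}$, with product $(x+\iota y)(x'+\iota y')=xx'-yy'+\iota(xy'+yx')$ and involutions $\overline{x+\iota y}=x-\iota y$ and $(x+\iota y)^c=x^c+\iota y^c$. **Circular domains.** For $D\subset\mathbb C$ put $\Omega_D=\bigcup_{I\in\mathbb S_A}\phi_I(D)$. A *circular domain* is a nonempty, open and connected set $\Omega\subset A$ of the form $\Omega=\Omega_D$. It is a *symmetric slice domain* if, in addition, $\Omega\cap\mathbb C_I$ is connected for each $I\in\mathbb S_A$. **Slice functions.** Let $D\subset\mathbb C$ be nonempty, open and symmetric with respect to the real axis. A *stem function* on $D$ is a function $F=F_1+\iota F_2:D\to A\otimes_{\mathbb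 R}\mathbb C$ with $F(\overline z)=\overline{F(z)}$ for all $z\in D$. It induces the *slice function* $f=\mathcal I(F):\Omega_D\to A$, $f(\phi_I(z))=F_1(z)+I\,F_2(z)$ for all $z\in D$, $I\in\mathbb S_A$. The set $D$ and the stem function $F$ are uniquely determined by $\Omega_D$ and $f$. The *normal function* of $f$ is $N(f)=\mathcal I(F\cdot F^c)$, where $F^c(z)=F(z)^c$. **Slice-Nash functions.** A function $g:D\to\mathbb C$ is *complex Nash* if every point of $D$ has an open neighbourhood $U\subset D$ on which $g$ is analytic and satisfies $P(z,g(z))=0$ for some nonzero polynomial $P\in\mathbb C[\mathsf z,\mathsf t]$. A *splitting base* of $A$ associated to $I\in\mathbb S_A$ is a real vector base of $A$ of the form $\{1,I,I_1,II_1,\dots,I_u,II_u\}$. The function $f=\mathcal I(F)$ is *slice-Nash* on $\Omega_D$ if $F$ is holomorphic, that is, of class $C^1$ with $\partial F/\partial\alpha+\iota\,\partial F/\partial\beta=0$ on $D$, where $z=\alpha+\iota\beta$, and if, with respect to some splitting base $(e_r)_r$ of $A$ associated to some $I\in\mathbb S_A$, writing $F_s=\sum_r F_{s,r}e_r$ with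 $F_{s,r}:D\to\mathbb R$ for $s=1,2$, all the functions $F_{1,r}+\iota F_{2,r}:D\to\mathbb C$ are complex Nash. **Zeros.** Let $V(f)=\{x\in\Omega: f(x)=0\}$. For $x=\alpha+\beta I$ with $\alpha,\beta\in\mathbb R$ and $I\in\mathbb S_A$, let $\mathbb S_x=\alpha+\beta\,\mathbb S_A$. An *isolated zero* of $f$ is an isolated point of $V(f)$. An *isolated spherical zero* of $f$ is a sphere $\mathbb S_x\subset V(f)$ with $x\in A\setminus\mathbb R$ such that $U\cap V(f)=\mathbb S_x$ for some open set $U\subset A$. **Statement.** 1. Let $\Omega\subset A$ be a circular domain and $f:\Omega\to A$ a slice-Nash function such that $N(f)$ is not identically zero. Then $V(f)$ is a finite union of isolated zeros and isolated spherical zeros; that is, $f$ has only finitely many isolated zeros and only finitely many isolated spherical zeros, and $V(f)$ is the union of all of them. 2. In particular, let $\Omega\subset A$ be a symmetric slice domain and $f:\Omega\to A$ a slice-Nash function that is not identically zero. Then the conclusion of 1. holds for $f$. -/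

import Mathlib

noncomputable section

namespace SliceNash

open scoped Quaternion ComplexConjugate

/-- The real vector space underlying the octonions, `𝕆 = ℍ ⊕ ℓ ℍ`, with the Euclidean norm. -/
def Octonion : Type := WithLp 2 (ℍ[ℝ] × ℍ[ℝ])

namespace Octonion

/-- The octonion `α + ℓ β`. -/
def mk (α β : ℍ[ℝ]) : Octonion := WithLp.toLp 2 (α, β)

/-- The component `α` of `α + ℓ β`. -/
def fst (x : Octonion) : ℍ[ℝ] := (WithLp.ofLp x).1

/-- The component `β` of `α + ℓ β`. -/
def snd (x : Octonion) : ℍ[ℝ] := (WithLp.ofLp x).2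

instance : NormedAddCommGroup Octonion :=
  inferInstanceAs (NormedAddCommGroup (WithLp 2 (ℍ[ℝ] × ℍ[ℝ])))

instance : NormedSpace ℝ Octonion :=
  inferInstanceAs (NormedSpace ℝ (WithLp 2 (ℍ[ℝ] × ℍ[ℝ])))

instance : One Octonion := ⟨mk 1 0⟩

/-- The Cayley-Dickson product
`(α + ℓ β) (γ + ℓ δ) = (α γ - δ βᶜ) + ℓ (αᶜ δ + γ β)`. -/
instance : Mul Octonion :=
  ⟨fun x y => mk (x.fst * y.fst - y.snd * star x.snd) (star x.fst * y.snd + y.fst * x.snd)⟩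

/-- The involution `(α + ℓ β)ᶜ = αᶜ - ℓ β`. -/
instance : Star Octonion := ⟨fun x => mk (star x.fst) (-x.snd)⟩

end Octonion

/-! In what follows `A` only carries the operations that the definitions mention;
it is always instantiated with the quaternions `ℍ[ℝ]` or with `Octonion`. -/

/-- The complexified algebra `A ⊗ ℂ`, whose elements are written uniquely as
`x + ι y` with `x, y ∈ A`. -/
@[ext]
structure Complexified (A : Type) where
  /-- The component `x` of `x + ι y`. -/
  re : A
  /-- The component `y` of `x + ι y`. -/
  im : A

namespace Complexified

variable {A : Type} [NormedAddCommGroup A] [Mul A] [Star A]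

/-- `(x + ι y) (x' + ι y') = x x' - y y' + ι (x y' + y x')`. -/
instance : Mul (Complexified A) :=
  ⟨fun w w' => ⟨w.re * w'.re - w.im * w'.im, w.re * w'.im + w.im * w'.re⟩⟩

/-- The complex conjugation `x + ι y ↦ x - ι y`. -/
def bar (w : Complexified A) : Complexified A := ⟨w.re, -w.im⟩

/-- The involution `x + ι y ↦ xᶜ + ι yᶜ`. -/
def invol (w : Complexified A) : Complexified A := ⟨star w.re, star w.im⟩

end Complexified

section

variable {A : Type} [NormedAddCommGroup A] [NormedSpace ℝ A] [Mul A] [One A] [Star A]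

/-! ### Slices, circular sets -/

variable (A) in
/-- The sphere of imaginary units `{x ∈ A : t(x) = 0, n(x) = 1}`,
where `t(x) = x + xᶜ` and `n(x) = x xᶜ`. -/
def imaginaryUnits : Set A := {x | x + star x = 0 ∧ x * star x = 1}

/-- The map `ℂ → A`, `α + ι β ↦ α + β I`. -/
def phi (I : A) (z : ℂ) : A := z.re • (1 : A) + z.im • I

/-- The map `A ⊗ ℂ → A`, `x + ι y ↦ x + I y`, which evaluates a stem function
to a (left) slice function. -/
def phiTilde (I : A) (w : Complexified A) : A := w.re + I * w.im

variable (A) in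
/-- The circularised `Ω_D = ⋃_I φ_I(D)` of `D ⊆ ℂ`. -/
def circularised (D : Set ℂ) : Set A := {x | ∃ I ∈ imaginaryUnits A, ∃ z ∈ D, x = phi I z}

/-- A circular domain: a circular subset of `A` that is open and connected (and nonempty). -/
structure IsCircularDomain (Ω : Set A) : Prop where
  circular : ∃ D : Set ℂ, Ω = circularised A D
  isOpen : IsOpen Ω
  isConnected : IsConnected Ω

/-- A symmetric slice domain: a circular domain all of whose slices `Ω ∩ ℂ_I` are connected. -/
structure IsSymmetricSliceDomain (Ω : Set A) : Prop extends IsCircularDomain Ω where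
  slice_connected : ∀ I ∈ imaginaryUnits A, IsConnected (Ω ∩ Set.range (phi I))

/-! ### Stem functions and slice functions -/

/-- `F : D → A ⊗ ℂ` is a stem function on the nonempty open set `D`, which is symmetric
with respect to the real axis. Values of `F` outside `D` are irrelevant. -/
structure IsStemFunction (D : Set ℂ) (F : ℂ → Complexified A) : Prop where
  isOpen : IsOpen D
  nonempty : D.Nonempty
  symmetric : ∀ z ∈ D, conj z ∈ D
  intrinsic : ∀ z ∈ D, F (conj z) = (F z).bar

/-- `f : Ω → A` is the slice function induced by the stem function `F : D → A ⊗ ℂ`, where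
`Ω = Ω_D`; that is, `f (φ_I z) = F₁ z + I F₂ z` for all `z ∈ D` and all imaginary units `I`.
Values of `f` outside `Ω` are irrelevant. -/
structure IsInducedBy (Ω : Set A) (f : A → A) (D : Set ℂ) (F : ℂ → Complexified A) : Prop where
  stem : IsStemFunction D F
  eq_circularised : Ω = circularised A D
  comm : ∀ I ∈ imaginaryUnits A, ∀ z ∈ D, f (phi I z) = phiTilde I (F z)

/-- `F = F₁ + ι F₂` is of class `C¹` on `D` and satisfies the Cauchy-Riemann equations
`∂F₁/∂α = ∂F₂/∂β` and `∂F₁/∂β = - ∂F₂/∂α`. -/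
structure IsHolomorphicStem (D : Set ℂ) (F : ℂ → Complexified A) : Prop where
  contDiffOn_re : ContDiffOn ℝ 1 (fun z => (F z).re) D
  contDiffOn_im : ContDiffOn ℝ 1 (fun z => (F z).im) D
  cauchyRiemann₁ : ∀ z ∈ D,
    fderiv ℝ (fun z => (F z).re) z 1 = fderiv ℝ (fun z => (F z).im) z Complex.I
  cauchyRiemann₂ : ∀ z ∈ D,
    fderiv ℝ (fun z => (F z).re) z Complex.I = -fderiv ℝ (fun z => (F z).im) z 1

/-- `g` is the normal function `N(f)` on `Ω`, the slice function induced by `F · Fᶜ`,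
where `F` is the stem function that induces `f`. -/
def IsNormalFunction (Ω : Set A) (f g : A → A) : Prop :=
  ∃ (D : Set ℂ) (F : ℂ → Complexified A),
    IsInducedBy Ω f D F ∧ IsInducedBy Ω g D (fun z => F z * (F z).invol)

/-! ### Nash functions -/

/-- `g` is a complex Nash function on the open set `D ⊆ ℂ`: locally, it is analytic and
satisfies `P(z, g(z)) = 0` for some nonzero polynomial `P`. -/
def IsComplexNashOn (D : Set ℂ) (g : ℂ → ℂ) : Prop :=
  ∀ z₀ ∈ D, ∃ U : Set ℂ, IsOpen U ∧ z₀ ∈ U ∧ U ⊆ D ∧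
    ∃ P : MvPolynomial (Fin 2) ℂ, P ≠ 0 ∧ AnalyticOnNhd ℂ g U ∧
      ∀ z ∈ U, MvPolynomial.eval ![z, g z] P = 0

/-- `b` is a splitting base `{1, I, I₁, I I₁, …, I_u, I I_u}` of `A` associated to `I`, with
`b (k, 0) = I_k` (where `I₀ = 1`) and `b (k, 1) = I I_k`. Since `b` is a basis, `u` is
determined by `dim A = 2 (u + 1)`. -/
structure IsSplittingBase {u : ℕ} (I : A) (b : Module.Basis (Fin (u + 1) × Fin 2) ℝ A) :
    Prop where
  mem : I ∈ imaginaryUnits A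
  zero : b (0, 0) = 1
  mul : ∀ k, b (k, 1) = I * b (k, 0)

/-- `F` is a stem-Nash function on `D`: with respect to some splitting base, each component
`F₁^{k,ℓ} + ι F₂^{k,ℓ}` of `F = F₁ + ι F₂` is a complex Nash function on `D`. -/
def IsStemNash (D : Set ℂ) (F : ℂ → Complexified A) : Prop :=
  IsStemFunction D F ∧
    ∃ (u : ℕ) (I : A) (b : Module.Basis (Fin (u + 1) × Fin 2) ℝ A), IsSplittingBase I b ∧
      ∀ (k : Fin (u + 1)) (l : Fin 2),
        IsComplexNashOn D (fun z => ⟨b.repr (F z).re (k, l), b.repr (F z).im (k, l)⟩)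

/-- `f` is a slice-Nash function on `Ω`: it is induced by a stem function that is holomorphic
(so that `f` is slice regular) and stem-Nash. -/
def IsSliceNash (Ω : Set A) (f : A → A) : Prop :=
  ∃ (D : Set ℂ) (F : ℂ → Complexified A),
    IsInducedBy Ω f D F ∧ IsHolomorphicStem D F ∧ IsStemNash D F

/-! ### Zero sets -/

/-- `V(f) = {x ∈ Ω : f(x) = 0}`. -/
def zeroSet (Ω : Set A) (f : A → A) : Set A := {x | x ∈ Ω ∧ f x = 0}

/-- `𝕊_x = {α + β J : J an imaginary unit}` for `x = α + β I`. -/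
def sphereOf (x : A) : Set A :=
  {y | ∃ z : ℂ, (∃ I ∈ imaginaryUnits A, x = phi I z) ∧ ∃ J ∈ imaginaryUnits A, y = phi J z}

/-- The set of the isolated zeros of `f`: the isolated points of `V(f)`. -/
def isolatedZeros (Ω : Set A) (f : A → A) : Set A :=
  {x | ∃ U : Set A, IsOpen U ∧ U ∩ zeroSet Ω f = {x}}

/-- The collection of the isolated spherical zeros of `f`: the spheres `𝕊_x ⊆ V(f)` with
`x ∈ A \ ℝ` that are isolated in `V(f)`. -/
def isolatedSphericalZeros (Ω : Set A) (f : A → A) : Set (Set A) :=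
  {S | ∃ x : A, x ∉ Set.range (fun r : ℝ => r • (1 : A)) ∧ x ∈ Ω ∧ S = sphereOf x ∧
    ∃ U : Set A, IsOpen U ∧ U ∩ zeroSet Ω f = S}

/-- The zero set of `f` is a finite union of isolated zeros and isolated spherical zeros:
there are only finitely many of them, and together they exhaust `V(f)`. -/
structure HasFiniteZeroSet (Ω : Set A) (f : A → A) : Prop where
  finite_isolatedZeros : (isolatedZeros Ω f).Finite
  finite_isolatedSphericalZeros : (isolatedSphericalZeros Ω f).Finite
  zeroSet_eq : zeroSet Ω f = isolatedZeros Ω f ∪ ⋃₀ isolatedSphericalZeros Ω f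

end

end SliceNash

end

/-! Write F = x + ιy for the stem function. In a composition algebra F·Fᶜ takes its values in ℂ: it
is G = |x|² - |y|² + 2ι⟨x, y⟩. If f vanishes at α + βI, then x = -Iy, so |x| = |y| and x ⊥ y, hence
G(α + ιβ) = 0. The zeros of f therefore lie over zeros of G.

G is a quadratic expression in the complex Nash components of F, so it is holomorphic and locally
algebraic over ℂ[z]. Cancelling powers of t in a polynomial relation for G near a point where G ≠ 0
leaves some q with q(z, 0) ≢ 0. The identity principle extends q(z, G) = 0 to a connected set, on
which zeros of G are roots of q(z, 0) (`finite_zeros_of_isAlgebraic`). That set is the image of Ω in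
the closed upper half plane.

Over each of these finitely many points f has either a single zero or a whole sphere of zeros,
because (I - J)y = 0 forces I = J or y = 0 (`IsInducedBy.hasFiniteZeroSet`).

On a symmetric slice domain, G ≡ 0 forces F = 0 on a real interval, and then f ≡ 0 by the identity
principle (`IsInducedBy.eq_zero_of_normalNumber_eq_zero`). -/

noncomputable section

namespace SliceNash

open scoped Polynomial Polynomial.Bivariate Topology

/-! ### Algebraic functions of one complex variable -/

/-- Complex functions on `U ⊆ ℂ` as an algebra over the polynomial functions. -/
@[reducible]
def functionAlgebra (U : Set ℂ) : Algebra ℂ[X] (U → ℂ) :=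
  RingHom.toAlgebra (RingHom.pi fun z : U => Polynomial.evalRingHom (z : ℂ))

attribute [local instance] functionAlgebra

theorem algebraMap_functionAlgebra_apply {U : Set ℂ} (p : ℂ[X]) (z : U) :
    algebraMap ℂ[X] (U → ℂ) p z = p.eval (z : ℂ) := rfl

theorem aeval_functionAlgebra_apply {U : Set ℂ} (g : ℂ → ℂ) (q : ℂ[X][Y]) (z : U) :
    Polynomial.aeval (fun w : U => g w) q z =
      MvPolynomial.eval ![(z : ℂ), g z] (Polynomial.Bivariate.equivMvPolynomial ℂ q) := by
  induction q using Polynomial.induction_on' with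
  | add p q hp hq => simp only [map_add, Pi.add_apply, hp, hq]
  | monomial n a =>
    rw [← Polynomial.C_mul_X_pow_eq_monomial]
    simp only [map_mul, map_pow, Polynomial.aeval_C, Polynomial.aeval_X, Pi.mul_apply,
      Pi.pow_apply, Polynomial.Bivariate.equivMvPolynomial_X, MvPolynomial.eval_X,
      algebraMap_functionAlgebra_apply]
    congr 1
    induction a using Polynomial.induction_on' with
    | add p q hp hq => simp only [map_add, Polynomial.eval_add, hp, hq]
    | monomial n a =>
      rw [← Polynomial.C_mul_X_pow_eq_monomial]
      simp [Polynomial.Bivariate.equivMvPolynomial_C_C,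
        Polynomial.Bivariate.equivMvPolynomial_C_X]

/-- Phrasing the Nash condition as `IsAlgebraic` over ℂ[X] gives closure under sums and products,
although `U → ℂ` has zero divisors. -/
theorem isAlgebraic_of_eval_eq_zero {U : Set ℂ} {g : ℂ → ℂ} {P : MvPolynomial (Fin 2) ℂ}
    (hP : P ≠ 0) (h : ∀ z ∈ U, MvPolynomial.eval ![z, g z] P = 0) :
    IsAlgebraic ℂ[X] (fun z : U => g z) := by
  refine ⟨(Polynomial.Bivariate.equivMvPolynomial ℂ).symm P, by simpa using hP, ?_⟩
  ext z
  rw [aeval_functionAlgebra_apply, AlgEquiv.apply_symm_apply]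
  exact h z z.2

theorem isAlgebraic_const (U : Set ℂ) (c : ℂ) : IsAlgebraic ℂ[X] (fun _ : U => c) := by
  have : (fun _ : U => c) = algebraMap ℂ[X] (U → ℂ) (Polynomial.C c) := by
    ext z
    simp [algebraMap_functionAlgebra_apply]
  rw [this]
  exact isAlgebraic_algebraMap _

theorem isAlgebraic_finset_sum {R S ι : Type*} [CommRing R] [IsDomain R] [CommRing S]
    [Algebra R S] (s : Finset ι) (g : ι → S) (h : ∀ i ∈ s, IsAlgebraic R (g i)) :
    IsAlgebraic R (∑ i ∈ s, g i) :=
  Finset.sum_induction g (IsAlgebraic R) (fun _ _ ha hb => ha.add hb) isAlgebraic_zero h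

/-- A quadratic expression with constant coefficients in complex Nash functions is locally an
algebraic function. -/
theorem exists_isAlgebraic_quadratic {ι : Type*} [Fintype ι] {D : Set ℂ} {g : ι → ℂ → ℂ}
    (hg : ∀ i, IsComplexNashOn D (g i)) (c : ι → ι → ℂ) {z₀ : ℂ} (hz₀ : z₀ ∈ D) :
    ∃ U ∈ 𝓝 z₀, IsAlgebraic ℂ[X] (fun z : U => ∑ i, ∑ j, c i j * (g i z * g j z)) := by
  choose U hUo hzU _ P hP _ hPU using fun i => hg i z₀ hz₀
  refine ⟨⋂ i, U i, (Filter.iInter_mem.2 fun i => (hUo i).mem_nhds (hzU i)), ?_⟩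
  have hi : ∀ i, IsAlgebraic ℂ[X] (fun z : (⋂ i, U i : Set ℂ) => g i z) := fun i =>
    isAlgebraic_of_eval_eq_zero (hP i) fun z hz => hPU i z (Set.mem_iInter.1 hz i)
  have hs := isAlgebraic_finset_sum Finset.univ _ fun i _ =>
    isAlgebraic_finset_sum Finset.univ _ fun j _ =>
      (isAlgebraic_const (⋂ i, U i) (c i j)).mul ((hi i).mul (hi j))
  refine (congrArg (IsAlgebraic ℂ[X]) ?_).mp hs
  ext z
  simp only [Finset.sum_apply, Pi.mul_apply]

theorem IsComplexNashOn.analyticOnNhd {D : Set ℂ} {g : ℂ → ℂ} (hg : IsComplexNashOn D g) :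
    AnalyticOnNhd ℂ g D := fun z hz => by
  obtain ⟨U, _, hzU, _, _, _, h, _⟩ := hg z hz
  exact h z hzU

theorem finite_zeros_of_isAlgebraic {E U : Set ℂ} {G : ℂ → ℂ} {z₀ : ℂ}
    (hG : AnalyticOnNhd ℂ G E) (hE : IsPreconnected E) (hz₀ : z₀ ∈ E) (hU : U ∈ 𝓝 z₀)
    (hGz₀ : G z₀ ≠ 0) (halg : IsAlgebraic ℂ[X] (fun z : U => G z)) :
    {z ∈ E | G z = 0}.Finite := by
  obtain ⟨p, hp, hpG⟩ := halg
  -- On W the function G never vanishes, so it is a non-zero-divisor and powers of t cancel from its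
  -- relation.
  set W : Set ℂ := {z ∈ U | G z ≠ 0} with hW
  have hWz : W ∈ 𝓝 z₀ :=
    Filter.inter_mem hU ((hG z₀ hz₀).continuousAt.eventually_ne hGz₀)
  have hWalg : IsAlgebraic ℂ[X] (fun z : W => G z) := by
    refine ⟨p, hp, ?_⟩
    ext z
    have := congrFun hpG ⟨z, z.2.1⟩
    rw [aeval_functionAlgebra_apply] at this ⊢
    exact this
  have hreg : (fun z : W => G z) ∈ nonZeroDivisors (W → ℂ) := by
    refine mem_nonZeroDivisors_iff_right.2 fun x hx => ?_
    ext z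
    exact (mul_eq_zero.1 (congrFun hx z)).resolve_right z.2.2
  obtain ⟨q, hq0, hq⟩ := hWalg.exists_nonzero_coeff_and_aeval_eq_zero hreg
  set Q := Polynomial.Bivariate.equivMvPolynomial ℂ q
  have hQ : AnalyticOnNhd ℂ (fun z => MvPolynomial.eval ![z, G z] Q) E := fun z hz => by
    have h := AnalyticAt.aeval_mvPolynomial (𝕜 := ℂ) (A := ℂ) (z := z) (f := fun w => ![w, G w])
      (fun i => by fin_cases i; exacts [analyticAt_id, hG z hz]) Q
    simpa [MvPolynomial.aeval_eq_eval] using h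
  have hQ0 : Set.EqOn (fun z => MvPolynomial.eval ![z, G z] Q) 0 E := by
    refine hQ.eqOn_zero_of_preconnected_of_eventuallyEq_zero hE hz₀ ?_
    filter_upwards [hWz] with z hz
    have := congrFun hq ⟨z, hz⟩
    rwa [aeval_functionAlgebra_apply] at this
  refine ((q.coeff 0).roots.toFinset.finite_toSet).subset fun z hz => ?_
  rw [Finset.mem_coe, Multiset.mem_toFinset, Polynomial.mem_roots hq0]
  -- Over the one-point set {z} the restriction of G is 0, so `aeval` keeps only the constant
  -- coefficient of q.
  have h := aeval_functionAlgebra_apply (U := {z}) G q ⟨z, rfl⟩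
  replace h := h.trans (hQ0 hz.1)
  have h0 : (fun w : ({z} : Set ℂ) => G w) = 0 := by
    ext ⟨w, hw⟩
    rw [Set.mem_singleton_iff] at hw
    subst hw
    exact hz.2
  rw [h0, ← Polynomial.coeff_zero_eq_aeval_zero'] at h
  exact h

end SliceNash

end

noncomputable section

namespace SliceNash

open scoped ComplexConjugate Topology

/-! ### Composition algebras -/

/-- The Euclidean form `B` of a finite-dimensional real composition algebra with conjugation `star`,
whose imaginary units form a sphere of positive dimension. -/
structure IsCompositionForm {A : Type} [NormedAddCommGroup A] [NormedSpace ℝ A] [Mul A] [One A]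
    [Star A] (B : A →ₗ[ℝ] A →ₗ[ℝ] ℝ) : Prop where
  three_le_finrank : 3 ≤ Module.finrank ℝ A
  symm : ∀ x y, B x y = B y x
  self_eq : ∀ x, B x x = ‖x‖ ^ 2
  one_one : B 1 1 = 1
  mem_units : ∀ x, x ∈ imaginaryUnits A ↔ B 1 x = 0 ∧ B x x = 1
  one_mul : ∀ x : A, 1 * x = x
  add_mul : ∀ x y z : A, (x + y) * z = x * z + y * z
  mul_add : ∀ x y z : A, x * (y + z) = x * y + x * z
  smul_mul : ∀ (r : ℝ) (x y : A), (r • x) * y = r • (x * y)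
  mul_smul : ∀ (r : ℝ) (x y : A), x * (r • y) = r • (x * y)
  mul_self : ∀ x y : A, B (x * y) (x * y) = B x x * B y y
  mul_star : ∀ x : A, x * star x = B x x • (1 : A)
  mul_star_add : ∀ x y : A, x * star y + y * star x = (2 * B x y) • (1 : A)

variable {A : Type} [NormedAddCommGroup A] [NormedSpace ℝ A] [Mul A] [One A] [Star A]

/-- The point of the closed upper half plane over which `x` lies. -/
def upperPoint (B : A →ₗ[ℝ] A →ₗ[ℝ] ℝ) (x : A) : ℂ := ⟨B 1 x, √(B x x - B 1 x ^ 2)⟩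

omit [Mul A] [Star A] in
theorem upperPoint_im_nonneg (B : A →ₗ[ℝ] A →ₗ[ℝ] ℝ) (x : A) : 0 ≤ (upperPoint B x).im :=
  Real.sqrt_nonneg _

/-- The sphere of the points of `A` that lie over `z`. -/
def sphereOver (A : Type) [NormedAddCommGroup A] [NormedSpace ℝ A] [Mul A] [One A] [Star A]
    (z : ℂ) : Set A :=
  (fun I => phi I z) '' imaginaryUnits A

omit [Mul A] [Star A] in
theorem phi_neg (I : A) (z : ℂ) : phi (-I) z = phi I (conj z) := by
  simp [phi]

omit [Mul A] [Star A] in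
theorem continuous_phi (z : ℂ) : Continuous fun I : A => phi I z := by
  unfold phi
  fun_prop

namespace IsCompositionForm

variable {B : A →ₗ[ℝ] A →ₗ[ℝ] ℝ} (hB : IsCompositionForm B)

include hB

theorem finiteDimensional : FiniteDimensional ℝ A :=
  Module.finite_of_finrank_pos (lt_of_lt_of_le (by norm_num) hB.three_le_finrank)

theorem eq_zero_of_self {x : A} (h : B x x = 0) : x = 0 := by
  rw [hB.self_eq] at h
  simpa using h

theorem neg_mul (x y : A) : -x * y = -(x * y) := by
  simpa using hB.smul_mul (-1) x y

theorem mul_neg (x y : A) : x * -y = -(x * y) := by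
  simpa using hB.mul_smul (-1) x y

theorem sub_mul (x y z : A) : (x - y) * z = x * z - y * z := by
  rw [sub_eq_add_neg, hB.add_mul, hB.neg_mul, sub_eq_add_neg]

theorem mul_sub (x y z : A) : x * (y - z) = x * y - x * z := by
  rw [sub_eq_add_neg, hB.mul_add, hB.mul_neg, sub_eq_add_neg]

theorem mul_zero (x : A) : x * 0 = 0 := by
  simpa using hB.mul_smul 0 x 0

theorem eq_zero_or_of_mul_eq_zero {x y : A} (h : x * y = 0) : x = 0 ∨ y = 0 := by
  have := hB.mul_self x y
  rw [h, map_zero, eq_comm, mul_eq_zero] at this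
  exact this.imp hB.eq_zero_of_self hB.eq_zero_of_self

theorem neg_mem {I : A} (hI : I ∈ imaginaryUnits A) : -I ∈ imaginaryUnits A := by
  rw [hB.mem_units] at hI ⊢
  simpa using hI

theorem unit_mul_self {I : A} (hI : I ∈ imaginaryUnits A) (y : A) :
    B (I * y) (I * y) = B y y := by
  rw [hB.mul_self, ((hB.mem_units I).1 hI).2, _root_.one_mul]

/-- Expand |(1 + I)y|² = |1 + I|²|y|² = 2|y|²; the cross term has to vanish. -/
theorem unit_mul_orthogonal {I : A} (hI : I ∈ imaginaryUnits A) (y : A) : B (I * y) y = 0 := by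
  have h := hB.mul_self (1 + I) y
  obtain ⟨h1, h2⟩ := (hB.mem_units I).1 hI
  rw [hB.add_mul, hB.one_mul] at h
  simp only [map_add, LinearMap.add_apply, hB.unit_mul_self hI, hB.one_one, h1, h2,
    hB.symm I 1, hB.symm y (I * y)] at h
  linarith

theorem one_phi {I : A} (hI : I ∈ imaginaryUnits A) (z : ℂ) : B 1 (phi I z) = z.re := by
  simp [phi, hB.one_one, ((hB.mem_units I).1 hI).1]

theorem phi_self {I : A} (hI : I ∈ imaginaryUnits A) (z : ℂ) :
    B (phi I z) (phi I z) = z.re ^ 2 + z.im ^ 2 := by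
  obtain ⟨h1, h2⟩ := (hB.mem_units I).1 hI
  simp [phi, hB.one_one, h1, h2, hB.symm I 1]
  ring

theorem upperPoint_phi {I : A} (hI : I ∈ imaginaryUnits A) (z : ℂ) :
    upperPoint B (phi I z) = ⟨z.re, |z.im|⟩ := by
  simp [upperPoint, hB.one_phi hI, hB.phi_self hI, Real.sqrt_sq_eq_abs]

theorem upperPoint_phi_of_nonneg {I : A} (hI : I ∈ imaginaryUnits A) {z : ℂ} (hz : 0 ≤ z.im) :
    upperPoint B (phi I z) = z := by
  rw [hB.upperPoint_phi hI, abs_of_nonneg hz]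

theorem continuous_form_left (x : A) : Continuous (B x) :=
  have := hB.finiteDimensional
  LinearMap.continuous_of_finiteDimensional _

theorem continuous_upperPoint : Continuous (upperPoint B) := by
  have h : upperPoint B = fun x => Complex.equivRealProdCLM.symm
      (B 1 x, √(‖x‖ ^ 2 - B 1 x ^ 2)) := by
    funext x
    apply Complex.ext <;> simp [upperPoint, hB.self_eq]
  rw [h]
  have := hB.continuous_form_left 1
  fun_prop

/-- This is the unit sphere of the hyperplane 1^⊥, whose dimension is at least 2 by
`three_le_finrank`. -/
theorem isPreconnected_units : IsPreconnected (imaginaryUnits A) := by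
  have := hB.finiteDimensional
  have hrank : 1 < Module.rank ℝ (LinearMap.ker (B 1)) := by
    have h1 := LinearMap.finrank_range_add_finrank_ker (B 1)
    have h2 : Module.finrank ℝ (LinearMap.range (B 1)) ≤ 1 := by
      simpa using Submodule.finrank_le (LinearMap.range (B 1))
    have h3 := hB.three_le_finrank
    rw [← Module.finrank_eq_rank]
    exact_mod_cast (by omega : 1 < Module.finrank ℝ (LinearMap.ker (B 1)))
  have himg : imaginaryUnits A = (Subtype.val : LinearMap.ker (B 1) → A) '' Metric.sphere 0 1 := by
    ext x
    have hn : ‖x‖ ^ 2 = 1 ↔ ‖x‖ = 1 := pow_eq_one_iff_of_nonneg (norm_nonneg x) two_ne_zero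
    simp only [hB.mem_units, hB.self_eq, hn, Set.mem_image, mem_sphere_zero_iff_norm,
      Subtype.exists, exists_and_right, exists_eq_right]
    constructor
    · rintro ⟨h1, h2⟩
      exact ⟨h1, h2⟩
    · rintro ⟨h1, h2⟩
      exact ⟨h1, h2⟩
  rw [himg]
  exact (isPreconnected_sphere hrank 0 1).image _ continuous_subtype_val.continuousOn

theorem isPreconnected_sphereOver (z : ℂ) : IsPreconnected (sphereOver A z) :=
  hB.isPreconnected_units.image _ (continuous_phi z).continuousOn

theorem sphereOver_conj (z : ℂ) : sphereOver A (conj z) = sphereOver A z := by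
  have h : ∀ w : ℂ, sphereOver A (conj w) ⊆ sphereOver A w := by
    rintro w _ ⟨I, hI, rfl⟩
    exact ⟨-I, hB.neg_mem hI, phi_neg I w⟩
  refine (h z).antisymm ?_
  simpa using h (conj z)

/-- A point of a circular set is determined by an imaginary unit and its upper point. -/
theorem exists_eq_phi_upperPoint {I : A} (hI : I ∈ imaginaryUnits A) (z : ℂ) :
    ∃ J ∈ imaginaryUnits A, phi I z = phi J (upperPoint B (phi I z)) := by
  rw [hB.upperPoint_phi hI]
  rcases le_total 0 z.im with h | h
  · exact ⟨I, hI, by rw [abs_of_nonneg h]⟩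
  · refine ⟨-I, hB.neg_mem hI, ?_⟩
    rw [phi_neg, abs_of_nonpos h]
    congr 1
    apply Complex.ext <;> simp

/-- The parameter z of a point is unique up to conjugation, which does not change the sphere. -/
theorem sphereOf_phi {I : A} (hI : I ∈ imaginaryUnits A) (z : ℂ) :
    sphereOf (phi I z) = sphereOver A z := by
  ext y
  constructor
  · rintro ⟨w, ⟨J, hJ, hw⟩, K, hK, rfl⟩
    have h := congrArg (upperPoint B) hw
    rw [hB.upperPoint_phi hI, hB.upperPoint_phi hJ, Complex.mk.injEq, abs_eq_abs] at h
    obtain ⟨h1, h2 | h2⟩ := h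
    · rw [show w = z from Complex.ext h1.symm h2.symm]
      exact ⟨K, hK, rfl⟩
    · rw [← hB.sphereOver_conj, show conj z = w by apply Complex.ext <;> simp [h1, h2]]
      exact ⟨K, hK, rfl⟩
  · rintro ⟨K, hK, rfl⟩
    exact ⟨z, ⟨I, hI, rfl⟩, K, hK, rfl⟩

end IsCompositionForm

/-! ### Zeros of slice functions, sphere by sphere -/

section Induced

variable {B : A →ₗ[ℝ] A →ₗ[ℝ] ℝ} (hB : IsCompositionForm B)
  {Ω : Set A} {f : A → A} {D : Set ℂ} {F : ℂ → Complexified A} (hf : IsInducedBy Ω f D F)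

include hB hf

theorem IsInducedBy.upperPoint_mem {x : A} (hx : x ∈ Ω) :
    upperPoint B x ∈ D ∧ ∃ I ∈ imaginaryUnits A, x = phi I (upperPoint B x) := by
  rw [hf.eq_circularised] at hx
  obtain ⟨I, hI, z, hz, rfl⟩ := hx
  refine ⟨?_, hB.exists_eq_phi_upperPoint hI z⟩
  rw [hB.upperPoint_phi hI]
  rcases le_total 0 z.im with h | h
  · rwa [abs_of_nonneg h]
  · rw [abs_of_nonpos h]
    convert hf.stem.symmetric z hz using 1
    apply Complex.ext <;> simp

omit hB in
theorem IsInducedBy.phi_mem {I : A} (hI : I ∈ imaginaryUnits A) {z : ℂ} (hz : z ∈ D) :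
    phi I z ∈ Ω := by
  rw [hf.eq_circularised]
  exact ⟨I, hI, z, hz, rfl⟩

/-- If a slice function vanishes at two points of a sphere, then it vanishes on the sphere. -/
theorem IsInducedBy.sphereOver_subset_zeroSet {x y : A} (hx : x ∈ zeroSet Ω f)
    (hy : y ∈ zeroSet Ω f) (hxy : upperPoint B x = upperPoint B y) (hne : x ≠ y) :
    sphereOver A (upperPoint B x) ⊆ zeroSet Ω f := by
  obtain ⟨hz, I, hI, hxI⟩ := hf.upperPoint_mem hB hx.1
  obtain ⟨_, J, hJ, hyJ⟩ := hf.upperPoint_mem hB hy.1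
  rw [← hxy] at hyJ
  set z := upperPoint B x
  have h1 : phiTilde I (F z) = 0 := by rw [← hf.comm I hI z hz, ← hxI]; exact hx.2
  have h2 : phiTilde J (F z) = 0 := by rw [← hf.comm J hJ z hz, ← hyJ]; exact hy.2
  have h3 : (I - J) * (F z).im = 0 := by
    rw [hB.sub_mul]
    unfold phiTilde at h1 h2
    rw [← sub_eq_zero.2 (h1.trans h2.symm)]
    abel
  have h4 : (F z).im = 0 := by
    refine (hB.eq_zero_or_of_mul_eq_zero h3).resolve_left fun h => hne ?_
    rw [hxI, hyJ, sub_eq_zero.1 h]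
  have h5 : (F z).re = 0 := by simpa [phiTilde, h4, hB.mul_zero] using h1
  rintro _ ⟨K, hK, rfl⟩
  refine ⟨hf.phi_mem hK hz, ?_⟩
  simp [hf.comm K hK z hz, phiTilde, h4, h5, hB.mul_zero]

theorem IsInducedBy.sphereOf_eq {x : A} (hx : x ∈ Ω) :
    sphereOf x = sphereOver A (upperPoint B x) := by
  obtain ⟨_, I, hI, hxI⟩ := hf.upperPoint_mem hB hx
  conv_lhs => rw [hxI]
  exact hB.sphereOf_phi hI _

theorem IsInducedBy.zeroSet_fiber {z : ℂ} (hs : sphereOver A z ⊆ zeroSet Ω f) (hz : 0 ≤ z.im) :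
    {x ∈ zeroSet Ω f | upperPoint B x = z} = sphereOver A z := by
  ext x
  constructor
  · rintro ⟨hx, rfl⟩
    obtain ⟨_, I, hI, hxI⟩ := hf.upperPoint_mem hB hx.1
    exact ⟨I, hI, hxI.symm⟩
  · intro hx
    refine ⟨hs hx, ?_⟩
    obtain ⟨I, hI, rfl⟩ := hx
    exact hB.upperPoint_phi_of_nonneg hI hz

/-- If the zeros of a slice function lie over finitely many points of the upper half plane, then
its zero set is a finite union of isolated zeros and isolated spherical zeros. -/
theorem IsInducedBy.hasFiniteZeroSet (hfin : (upperPoint B '' zeroSet Ω f).Finite) :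
    HasFiniteZeroSet Ω f := by
  have hfiber : ∀ z, ∃ U : Set A, IsOpen U ∧
      U ∩ zeroSet Ω f = {x ∈ zeroSet Ω f | upperPoint B x = z} := fun z => by
    -- The other upper points of zeros form a finite, hence closed set, so each fibre is open in
    -- V(f).
    refine ⟨upperPoint B ⁻¹' (upperPoint B '' zeroSet Ω f \ {z})ᶜ,
      (hfin.sdiff.isClosed.isOpen_compl).preimage hB.continuous_upperPoint, ?_⟩
    ext x
    simp only [Set.mem_inter_iff, Set.mem_preimage, Set.mem_compl_iff, Set.mem_sdiff,
      Set.mem_singleton_iff, not_and, not_not, Set.mem_ofPred_eq]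
    exact ⟨fun h => ⟨h.2, h.1 ⟨x, h.2, rfl⟩⟩, fun h => ⟨fun _ => h.2, h.1⟩⟩
  have hisol : isolatedZeros Ω f ⊆ zeroSet Ω f := by
    rintro x ⟨U, _, hU⟩
    exact (hU.ge rfl : x ∈ U ∩ zeroSet Ω f).2
  refine ⟨?_, ?_, ?_⟩
  · refine Set.Finite.of_finite_image (hfin.subset (Set.image_mono hisol)) ?_
    intro x hx y hy hxy
    by_contra hne
    have hs := hf.sphereOver_subset_zeroSet hB (hisol hx) (hisol hy) hxy hne
    have hfib := hf.zeroSet_fiber hB hs (upperPoint_im_nonneg B x)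
    have hxS : x ∈ sphereOver A (upperPoint B x) := hfib.le ⟨hisol hx, rfl⟩
    have hyS : y ∈ sphereOver A (upperPoint B x) := hfib.le ⟨hisol hy, hxy.symm⟩
    obtain ⟨U, hU, hUx⟩ := hx
    -- Two zeros over one point make the whole sphere vanish. It is connected and covered by U and
    -- the complement of x, so U contains a second zero.
    obtain ⟨w, hwS, hwU, hwx⟩ := hB.isPreconnected_sphereOver (upperPoint B x) U {x}ᶜ hU
      isOpen_compl_singleton
      (fun w _ => by
        by_cases hw : w = x
        · exact Or.inl (hw ▸ (hUx.ge rfl : x ∈ U ∩ zeroSet Ω f).1)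
        · exact Or.inr hw)
      ⟨x, hxS, (hUx.ge rfl : x ∈ U ∩ zeroSet Ω f).1⟩ ⟨y, hyS, Ne.symm hne⟩
    exact hwx (hUx.le ⟨hwU, hs hwS⟩)
  · refine (hfin.image (sphereOver A)).subset ?_
    rintro S ⟨x, _, hx, rfl, U, _, hU⟩
    rw [hf.sphereOf_eq hB hx] at hU ⊢
    obtain ⟨_, I, hI, hxI⟩ := hf.upperPoint_mem hB hx
    have hxS : x ∈ sphereOver A (upperPoint B x) := ⟨I, hI, hxI.symm⟩
    exact ⟨_, ⟨x, (hU.ge hxS).2, rfl⟩, rfl⟩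
  · refine Set.Subset.antisymm ?_ (Set.union_subset hisol ?_)
    · intro x hx
      obtain ⟨U, hU, hUx⟩ := hfiber (upperPoint B x)
      by_cases hsub : ∀ y ∈ zeroSet Ω f, upperPoint B y = upperPoint B x → y = x
      · refine Or.inl ⟨U, hU, hUx.trans ?_⟩
        ext y
        exact ⟨fun h => hsub y h.1 h.2, fun h => by rw [Set.mem_singleton_iff.1 h]; exact ⟨hx, rfl⟩⟩
      · push Not at hsub
        obtain ⟨y, hy, hyx, hne⟩ := hsub
        have hs := hf.sphereOver_subset_zeroSet hB hx hy hyx.symm hne.symm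
        have hfib := hf.zeroSet_fiber hB hs (upperPoint_im_nonneg B x)
        refine Or.inr ⟨sphereOver A (upperPoint B x), ⟨x, ?_, hx.1,
          (hf.sphereOf_eq hB hx.1).symm, U, hU, hUx.trans hfib⟩, hfib.le ⟨hx, rfl⟩⟩
        -- If x were real, the fibre through x would be a single point, contradicting y ≠ x.
        rintro ⟨r, hr⟩
        have him : (upperPoint B x).im = 0 := by
          simp [← hr, upperPoint, hB.one_one, sq]
        obtain ⟨_, I, _, hxI⟩ := hf.upperPoint_mem hB hx.1
        obtain ⟨_, J, _, hyJ⟩ := hf.upperPoint_mem hB hy.1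
        refine hne ?_
        rw [hyJ, hxI, hyx]
        simp [phi, him]
    · rintro x ⟨S, ⟨_, _, _, _, U, _, hU⟩, hx⟩
      exact (hU.ge hx).2

end Induced

end SliceNash

end

noncomputable section

namespace SliceNash

open scoped ComplexConjugate Topology

variable {A : Type} [NormedAddCommGroup A] [NormedSpace ℝ A] [Mul A] [One A] [Star A]

/-! ### The normal function -/

/-- The complex number `|x|² - |y|² + 2 ι ⟨x, y⟩`, which represents `w wᶜ` for `w = x + ι y`. -/
def normalNumber (B : A →ₗ[ℝ] A →ₗ[ℝ] ℝ) (w : Complexified A) : ℂ :=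
  ⟨B w.re w.re - B w.im w.im, 2 * B w.re w.im⟩

-- This is the complexified quadratic form of B in coordinates; it exhibits G as quadratic in the
-- components that are assumed to be Nash.
omit [Mul A] [One A] [Star A] in
theorem normalNumber_eq_sum {ι : Type*} [Fintype ι] (B : A →ₗ[ℝ] A →ₗ[ℝ] ℝ)
    (hsymm : ∀ x y, B x y = B y x) (b : Module.Basis ι ℝ A) (w : Complexified A) :
    normalNumber B w = ∑ i, ∑ j, (B (b i) (b j) : ℂ) *
      ((⟨b.repr w.re i, b.repr w.im i⟩ : ℂ) * ⟨b.repr w.re j, b.repr w.im j⟩) := by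
  have h : ∀ x y, B x y = ∑ i, ∑ j, B (b i) (b j) * (b.repr x i * b.repr y j) := fun x y => by
    conv_lhs => rw [← b.sum_repr x, ← b.sum_repr y]
    simp only [map_sum, LinearMap.sum_apply, map_smul, LinearMap.smul_apply, smul_eq_mul,
      Finset.mul_sum]
    rw [Finset.sum_comm]
    exact Finset.sum_congr rfl fun i _ => Finset.sum_congr rfl fun j _ => by ring
  apply Complex.ext
  · simp only [normalNumber, Complex.re_sum, Complex.mul_re, Complex.ofReal_re, Complex.ofReal_im,
      zero_mul,
      sub_zero, h w.re w.re,
      h w.im w.im, ← Finset.sum_sub_distrib, ← _root_.mul_sub]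
  · simp only [normalNumber, Complex.im_sum, Complex.mul_im, Complex.ofReal_re, Complex.ofReal_im,
      zero_mul,
      add_zero]
    rw [two_mul]
    nth_rw 2 [hsymm]
    simp only [h w.re w.im, h w.im w.re, ← Finset.sum_add_distrib, ← _root_.mul_add]

section Induced

variable {B : A →ₗ[ℝ] A →ₗ[ℝ] ℝ} (hB : IsCompositionForm B)

include hB

/-- The elements xxᶜ, yyᶜ and xyᶜ + yxᶜ are real. The factor `I * 1` stays because
`IsCompositionForm` records 1 only as a left identity. -/
theorem IsCompositionForm.phiTilde_mul_invol (I : A) (w : Complexified A) :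
    phiTilde I (w * w.invol) =
      (normalNumber B w).re • (1 : A) + (normalNumber B w).im • (I * 1) := by
  change w.re * star w.re - w.im * star w.im + I * (w.re * star w.im + w.im * star w.re) = _
  rw [hB.mul_star, hB.mul_star, hB.mul_star_add, hB.mul_smul, ← sub_smul]
  rfl

theorem IsCompositionForm.normalNumber_eq_zero {I : A} (hI : I ∈ imaginaryUnits A)
    {w : Complexified A} (h : phiTilde I w = 0) : normalNumber B w = 0 := by
  have hre : w.re = -(I * w.im) := eq_neg_of_add_eq_zero_left h
  apply Complex.ext
  · simp [normalNumber, hre, hB.unit_mul_self hI]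
  · simp [normalNumber, hre, hB.unit_mul_orthogonal hI]

/-- Adding the values at I and -I recovers F₁, and I can then be cancelled. This matches the stem
function in `IsSliceNash` with the one in `IsNormalFunction`. -/
theorem IsInducedBy.stem_unique {Ω : Set A} {f : A → A} {D D' : Set ℂ}
    {F F' : ℂ → Complexified A} (hf : IsInducedBy Ω f D F) (hf' : IsInducedBy Ω f D' F')
    {I : A} (hI : I ∈ imaginaryUnits A) {z : ℂ} (hz : z ∈ D) (hz' : z ∈ D') : F z = F' z := by
  have h1 := (hf.comm I hI z hz).symm.trans (hf'.comm I hI z hz')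
  have h2 := (hf.comm (-I) (hB.neg_mem hI) z hz).symm.trans (hf'.comm (-I) (hB.neg_mem hI) z hz')
  simp only [phiTilde, hB.neg_mul] at h1 h2
  have hre : (F z).re = (F' z).re := by
    have h3 : (2 : ℝ) • (F z).re = (2 : ℝ) • (F' z).re := by
      rw [two_smul, two_smul]
      have := congrArg₂ (· + ·) h1 h2
      convert this using 1 <;> abel
    exact smul_right_injective A two_ne_zero h3
  refine Complexified.ext hre ?_
  rw [hre, add_right_inj, ← sub_eq_zero, ← hB.mul_sub] at h1
  refine sub_eq_zero.1 ((hB.eq_zero_or_of_mul_eq_zero h1).resolve_left fun h => ?_)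
  have := ((hB.mem_units I).1 hI).2
  simp [h] at this

variable {Ω : Set A} {f : A → A} {D : Set ℂ} {F : ℂ → Complexified A} (hf : IsInducedBy Ω f D F)

include hf

/-- A slice-Nash function whose normal function does not vanish identically has a finite zero
set. -/
theorem IsInducedBy.hasFiniteZeroSet_of_normalNumber_ne_zero (hΩ : IsConnected Ω)
    (hF : IsStemNash D F) {x : A} (hx : x ∈ Ω) (hne : normalNumber B (F (upperPoint B x)) ≠ 0) :
    HasFiniteZeroSet Ω f := by
  obtain ⟨-, u, -, b, -, hb⟩ := hF
  -- D itself may be disconnected, for instance when Ω misses the real axis, but E is a continuous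
  -- image of Ω.
  set E := upperPoint B '' Ω
  have hED : E ⊆ D := by
    rintro _ ⟨y, hy, rfl⟩
    exact (hf.upperPoint_mem hB hy).1
  have hE : IsPreconnected E :=
    hΩ.isPreconnected.image _ hB.continuous_upperPoint.continuousOn
  have hsum := fun z => normalNumber_eq_sum B hB.symm b (F z)
  have hxE : upperPoint B x ∈ E := ⟨x, hx, rfl⟩
  have han : AnalyticOnNhd ℂ (fun z => normalNumber B (F z)) E := by
    simp only [hsum]
    refine fun z hz => Finset.analyticAt_fun_sum _ fun i _ => Finset.analyticAt_fun_sum _ fun j _ => ?_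
    exact analyticAt_const.mul
      (((hb i.1 i.2).analyticOnNhd z (hED hz)).mul ((hb j.1 j.2).analyticOnNhd z (hED hz)))
  obtain ⟨U, hU, halg⟩ := exists_isAlgebraic_quadratic (D := D)
    (g := fun i z => ⟨b.repr (F z).re i, b.repr (F z).im i⟩) (fun i => hb i.1 i.2)
    (fun i j => (B (b i) (b j) : ℂ)) (hED hxE)
  simp only [← hsum] at halg
  have hfin := finite_zeros_of_isAlgebraic han hE hxE hU hne halg
  refine hf.hasFiniteZeroSet hB (hfin.subset ?_)
  rintro _ ⟨y, hy, rfl⟩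
  refine ⟨⟨y, hy.1, rfl⟩, ?_⟩
  obtain ⟨hz, I, hI, hyI⟩ := hf.upperPoint_mem hB hy.1
  refine hB.normalNumber_eq_zero hI ?_
  rw [← hf.comm I hI _ hz, ← hyI]
  exact hy.2

/-- At a real point the symmetry of F gives F₂ = 0, so G reduces to |F₁|². -/
theorem IsInducedBy.stem_eq_zero_of_conj_eq {z : ℂ} (hz : z ∈ D) (hconj : conj z = z)
    (h : normalNumber B (F z) = 0) : F z = ⟨0, 0⟩ := by
  have him : (F z).im = 0 := by
    have h1 := congrArg Complexified.im (hf.stem.intrinsic z hz)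
    rw [hconj] at h1
    have h2 : (2 : ℝ) • (F z).im = 0 := by
      rw [two_smul]
      exact eq_neg_iff_add_eq_zero.1 h1
    exact (smul_eq_zero.1 h2).resolve_left two_ne_zero
  refine Complexified.ext (hB.eq_zero_of_self ?_) him
  simpa [normalNumber, him] using congrArg Complex.re h

/-- The form `B I` reads off β on the slice ℂ_I. Its image is an interval containing some β and -β,
hence 0. -/
theorem IsInducedBy.exists_mem_im_eq_zero {I : A} (hI : I ∈ imaginaryUnits A)
    (hconn : IsConnected (Ω ∩ Set.range (phi I))) : ∃ z ∈ D, z.im = 0 := by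
  obtain ⟨z, hz⟩ := hf.stem.nonempty
  have key : ∀ w ∈ D, w.im ∈ B I '' (Ω ∩ Set.range (phi I)) := fun w hw =>
    ⟨phi I w, ⟨hf.phi_mem hI hw, w, rfl⟩, by
      simp [phi, hB.symm I 1, ((hB.mem_units I).1 hI).1, ((hB.mem_units I).1 hI).2]⟩
  have hpre : (B I '' (Ω ∩ Set.range (phi I))).OrdConnected :=
    (hconn.isPreconnected.image _ (hB.continuous_form_left I).continuousOn).ordConnected
  have h0 : (0 : ℝ) ∈ Set.uIcc z.im (conj z).im := by
    rw [Complex.conj_im, Set.mem_uIcc]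
    rcases le_total 0 z.im with h | h
    · exact Or.inr ⟨by linarith, h⟩
    · exact Or.inl ⟨h, by linarith⟩
  obtain ⟨_, ⟨hw, w, rfl⟩, hw0⟩ :=
    hpre.uIcc_subset (key z hz) (key _ (hf.stem.symmetric z hz)) h0
  have him : w.im = 0 := by
    simpa [phi, hB.symm I 1, ((hB.mem_units I).1 hI).1, ((hB.mem_units I).1 hI).2] using hw0
  refine ⟨_, (hf.upperPoint_mem hB hw).1, ?_⟩
  rw [hB.upperPoint_phi hI, him, abs_zero]

/-- On a symmetric slice domain, a slice-Nash function whose normal function vanishes is zero. -/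
theorem IsInducedBy.eq_zero_of_normalNumber_eq_zero (hΩ : IsSymmetricSliceDomain Ω)
    (hF : IsStemNash D F) (h : ∀ x ∈ Ω, normalNumber B (F (upperPoint B x)) = 0) :
    ∀ x ∈ Ω, f x = 0 := by
  intro x hx
  obtain ⟨-, u, -, b, -, hb⟩ := hF
  obtain ⟨hz, I, hI, hxI⟩ := hf.upperPoint_mem hB hx
  have hDE : ∀ z ∈ D, 0 ≤ z.im → z ∈ upperPoint B '' Ω := fun z hz h0 =>
    ⟨phi I z, hf.phi_mem hI hz, hB.upperPoint_phi_of_nonneg hI h0⟩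
  have hED : upperPoint B '' Ω ⊆ D := by
    rintro _ ⟨y, hy, rfl⟩
    exact (hf.upperPoint_mem hB hy).1
  have hE : IsPreconnected (upperPoint B '' Ω) :=
    hΩ.isConnected.isPreconnected.image _ hB.continuous_upperPoint.continuousOn
  obtain ⟨r, hrD, hr⟩ := hf.exists_mem_im_eq_zero hB hI (hΩ.slice_connected I hI)
  obtain ⟨r, rfl⟩ : ∃ s : ℝ, (s : ℂ) = r := ⟨r.re, by apply Complex.ext <;> simp [hr]⟩
  have htend : Filter.Tendsto (fun t : ℝ => (t : ℂ)) (𝓝[≠] r) (𝓝[≠] (r : ℂ)) :=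
    Complex.continuous_ofReal.continuousWithinAt.tendsto_nhdsWithin fun t ht => by
      simpa using ht
  -- Only real t near r are used; they accumulate at r, which is enough for the identity principle
  -- on the set E of upper points, even though E need not be open.
  have hev : ∀ᶠ t : ℝ in 𝓝[≠] r, F t = ⟨0, 0⟩ := by
    filter_upwards [htend.eventually (nhdsWithin_le_nhds (hf.stem.isOpen.mem_nhds hrD))] with t ht
    refine hf.stem_eq_zero_of_conj_eq hB ht (Complex.conj_ofReal t) ?_
    obtain ⟨y, hy, hyt⟩ := hDE t ht (by simp)
    rw [← hyt]
    exact h y hy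
  have hzero : ∀ i, (⟨b.repr (F (upperPoint B x)).re i, b.repr (F (upperPoint B x)).im i⟩ : ℂ)
      = 0 := fun i => by
    refine AnalyticOnNhd.eqOn_zero_of_preconnected_of_frequently_eq_zero
      ((hb i.1 i.2).analyticOnNhd.mono hED) hE (hDE r hrD (by simp)) (htend.frequently ?_)
      ⟨x, hx, rfl⟩
    refine (hev.mono fun t ht => ?_).frequently
    rw [ht]
    apply Complex.ext <;> simp
  have hre : (F (upperPoint B x)).re = 0 :=
    b.ext_elem fun i => by simpa using congrArg Complex.re (hzero i)
  have him : (F (upperPoint B x)).im = 0 :=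
    b.ext_elem fun i => by simpa using congrArg Complex.im (hzero i)
  rw [hxI, hf.comm I hI _ hz, phiTilde, hre, him, hB.mul_zero, add_zero]

end Induced

/-! ### Both assertions for an arbitrary composition form -/

variable {B : A →ₗ[ℝ] A →ₗ[ℝ] ℝ} (hB : IsCompositionForm B) {Ω : Set A} {f : A → A}

include hB

theorem IsSliceNash.hasFiniteZeroSet_of_normalFunction_ne_zero (hΩ : IsCircularDomain Ω)
    (hf : IsSliceNash Ω f) {Nf : A → A} (hN : IsNormalFunction Ω f Nf)
    (hne : ∃ x ∈ Ω, Nf x ≠ 0) : HasFiniteZeroSet Ω f := by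
  obtain ⟨D, F, hind, -, hF⟩ := hf
  obtain ⟨D', F', hind', hNind⟩ := hN
  obtain ⟨x, hx, hNx⟩ := hne
  obtain ⟨hz, I, hI, hxI⟩ := hind.upperPoint_mem hB hx
  have hz' := (hind'.upperPoint_mem hB hx).1
  refine hind.hasFiniteZeroSet_of_normalNumber_ne_zero hB hΩ.isConnected hF hx fun h0 => hNx ?_
  rw [hind.stem_unique hB hind' hI hz hz'] at h0
  rw [hxI, hNind.comm I hI _ hz', hB.phiTilde_mul_invol, h0]
  simp

theorem IsSliceNash.hasFiniteZeroSet_of_ne_zero (hΩ : IsSymmetricSliceDomain Ω)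
    (hf : IsSliceNash Ω f) (hne : ∃ x ∈ Ω, f x ≠ 0) : HasFiniteZeroSet Ω f := by
  obtain ⟨D, F, hind, -, hF⟩ := hf
  obtain ⟨x, hx, hfx⟩ := hne
  by_contra hcon
  refine hfx (hind.eq_zero_of_normalNumber_eq_zero hB hΩ hF (fun y hy => ?_) x hx)
  by_contra hy0
  exact hcon (hind.hasFiniteZeroSet_of_normalNumber_ne_zero hB hΩ.isConnected hF hy hy0)

end SliceNash

end

noncomputable section

namespace SliceNash

open scoped Quaternion

/-! ### Quaternions and octonions -/

theorem isCompositionForm_quaternion : IsCompositionForm (innerₗ ℍ[ℝ]) where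
  three_le_finrank := by rw [Quaternion.finrank_eq_four]; norm_num
  symm x y := by simp [real_inner_comm]
  self_eq x := by simp
  one_one := by simp
  mem_units x := by
    simp only [imaginaryUnits, Set.mem_ofPred_eq, innerₗ_apply_apply, Quaternion.inner_def,
      Quaternion.ext_iff]
    simp
    intro _ _
    and_intros <;> ring
  one_mul := _root_.one_mul
  add_mul := _root_.add_mul
  mul_add := _root_.mul_add
  smul_mul := smul_mul_assoc
  mul_smul := mul_smul_comm
  mul_self x y := by simp [mul_pow]
  mul_star x := by
    rw [Quaternion.self_mul_star, innerₗ_apply_apply, Quaternion.inner_self,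
      ← Quaternion.coe_mul_eq_smul, mul_one]
  mul_star_add x y := by
    simp only [innerₗ_apply_apply, Quaternion.inner_def]
    ext <;> simp <;> ring

namespace Octonion

@[ext] theorem ext {x y : Octonion} (h₁ : x.fst = y.fst) (h₂ : x.snd = y.snd) : x = y :=
  WithLp.ofLp_injective 2 (Prod.ext h₁ h₂)

@[simp] theorem fst_zero : (0 : Octonion).fst = 0 := rfl
@[simp] theorem snd_zero : (0 : Octonion).snd = 0 := rfl
@[simp] theorem fst_one : (1 : Octonion).fst = 1 := rfl
@[simp] theorem snd_one : (1 : Octonion).snd = 0 := rfl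
@[simp] theorem fst_add (x y : Octonion) : (x + y).fst = x.fst + y.fst := rfl
@[simp] theorem snd_add (x y : Octonion) : (x + y).snd = x.snd + y.snd := rfl
@[simp] theorem fst_smul (r : ℝ) (x : Octonion) : (r • x).fst = r • x.fst := rfl
@[simp] theorem snd_smul (r : ℝ) (x : Octonion) : (r • x).snd = r • x.snd := rfl
@[simp] theorem fst_star (x : Octonion) : (star x).fst = star x.fst := rfl
@[simp] theorem snd_star (x : Octonion) : (star x).snd = -x.snd := rfl
@[simp] theorem fst_mul (x y : Octonion) :
    (x * y).fst = x.fst * y.fst - y.snd * star x.snd := rfl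
@[simp] theorem snd_mul (x y : Octonion) :
    (x * y).snd = star x.fst * y.snd + y.fst * x.snd := rfl

/-- The Euclidean inner product of octonions. -/
def form : Octonion →ₗ[ℝ] Octonion →ₗ[ℝ] ℝ :=
  LinearMap.mk₂ ℝ (fun x y => inner ℝ x.fst y.fst + inner ℝ x.snd y.snd)
    (fun x y z => by simp [inner_add_left]; ring)
    (fun r x y => by simp [inner_smul_left]; ring)
    (fun x y z => by simp [inner_add_right]; ring)
    (fun r x y => by simp [inner_smul_right]; ring)

theorem form_apply (x y : Octonion) :
    form x y = inner ℝ x.fst y.fst + inner ℝ x.snd y.snd := rfl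

theorem finrank_eq_eight : Module.finrank ℝ Octonion = 8 := by
  have h : Module.finrank ℝ Octonion = Module.finrank ℝ (ℍ[ℝ] × ℍ[ℝ]) :=
    (WithLp.linearEquiv 2 ℝ (ℍ[ℝ] × ℍ[ℝ])).finrank_eq
  rw [h, Module.finrank_prod, Quaternion.finrank_eq_four]

theorem norm_sq_eq (x : Octonion) : ‖x‖ ^ 2 = ‖x.fst‖ ^ 2 + ‖x.snd‖ ^ 2 :=
  WithLp.prod_norm_sq_eq_of_L2 (α := ℍ[ℝ]) (β := ℍ[ℝ]) x

theorem isCompositionForm : IsCompositionForm form where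
  three_le_finrank := by rw [finrank_eq_eight]; norm_num
  symm x y := by simp [form_apply, real_inner_comm]
  self_eq x := by simp [form_apply, norm_sq_eq]
  one_one := by simp [form_apply]
  mem_units x := by
    simp only [imaginaryUnits, Set.mem_ofPred_eq, form_apply, Quaternion.inner_def,
      Quaternion.ext_iff, Octonion.ext_iff]
    simp
    intro _ _
    and_intros <;> ring
  one_mul x := by ext1 <;> simp
  add_mul x y z := by ext1 <;> simp [add_mul, mul_add] <;> abel
  mul_add x y z := by ext1 <;> simp [add_mul, mul_add] <;> abel
  smul_mul r x y := by ext1 <;> simp [smul_sub]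
  mul_smul r x y := by ext1 <;> simp [smul_sub]
  -- Degen's eight-square identity, checked in the sixteen real coordinates.
  mul_self x y := by
    simp only [form_apply, Quaternion.inner_def]
    simp
    ring
  mul_star x := by
    ext1
    · simp only [form_apply, Quaternion.inner_def]
      ext <;> simp <;> ring
    · simp
  mul_star_add x y := by
    ext1
    · simp only [form_apply, Quaternion.inner_def]
      ext <;> simp <;> ring
    · simp

end Octonion

end SliceNash

end

theorem proposition6p3 :
    -- the quaternionic case
    ((∀ (Ω : Set (Quaternion ℝ)) (f Nf : Quaternion ℝ → Quaternion ℝ),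
        SliceNash.IsCircularDomain Ω → SliceNash.IsSliceNash Ω f →
        SliceNash.IsNormalFunction Ω f Nf → (∃ x ∈ Ω, Nf x ≠ 0) →
        SliceNash.HasFiniteZeroSet Ω f) ∧
      (∀ (Ω : Set (Quaternion ℝ)) (f : Quaternion ℝ → Quaternion ℝ),
        SliceNash.IsSymmetricSliceDomain Ω → SliceNash.IsSliceNash Ω f →
        (∃ x ∈ Ω, f x ≠ 0) →
        SliceNash.HasFiniteZeroSet Ω f)) ∧
    -- the octonionic case
    ((∀ (Ω : Set SliceNash.Octonion) (f Nf : SliceNash.Octonion → SliceNash.Octonion),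
        SliceNash.IsCircularDomain Ω → SliceNash.IsSliceNash Ω f →
        SliceNash.IsNormalFunction Ω f Nf → (∃ x ∈ Ω, Nf x ≠ 0) →
        SliceNash.HasFiniteZeroSet Ω f) ∧
      (∀ (Ω : Set SliceNash.Octonion) (f : SliceNash.Octonion → SliceNash.Octonion),
        SliceNash.IsSymmetricSliceDomain Ω → SliceNash.IsSliceNash Ω f →
        (∃ x ∈ Ω, f x ≠ 0) →
        SliceNash.HasFiniteZeroSet Ω f)) := by
  refine ⟨⟨fun Ω f Nf hΩ hf hN hne => ?_, fun Ω f hΩ hf hne => ?_⟩,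
    fun Ω f Nf hΩ hf hN hne => ?_, fun Ω f hΩ hf hne => ?_⟩
  · exact SliceNash.IsSliceNash.hasFiniteZeroSet_of_normalFunction_ne_zero
      SliceNash.isCompositionForm_quaternion hΩ hf hN hne
  · exact SliceNash.IsSliceNash.hasFiniteZeroSet_of_ne_zero
      SliceNash.isCompositionForm_quaternion hΩ hf hne
  · exact SliceNash.IsSliceNash.hasFiniteZeroSet_of_normalFunction_ne_zero
      SliceNash.Octonion.isCompositionForm hΩ hf hN hne
  · exact SliceNash.IsSliceNash.hasFiniteZeroSet_of_ne_zero
      SliceNash.Octonion.isCompositionForm hΩ hf hne
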